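/- For simple graphs $G_1,\dots,G_k$, let $R(G_1,\dots,G_k)$ denote the multicolor Ramsey number, i.e. the smallest positive integer $N$ such that, whenever the edges of the complete graph $K_N$ are partitioned into $k$ (possibly empty) color classes forming graphs $H_1,\dots,H_k$ on the vertex set of $K_N$, at least one $H_i$ has a subgraph isomorphic to $G_i$. Let $S_t=K_{1,t}$ denote the star with $t$ edges and $nK_2$ the matching consisting of $n$ pairwise disjoint edges. Let $s\ge 0$ and $c\ge 1$, let $t_1,\dots,t_s$ and $n_1\ge n_2\ge\cdots\ge n_c$ be positive integers, and put $\Sigma=\sum_{i=1}^{s}(t_i-1)$ and $r=R(S_{t_1},\dots,S_{t_s})$. If $c=1$, put $n_2=0$, so that $\max\{n_1,2n_2\}=n_1$. Then $$R(S_{t_1},\dots,S_{t_s},n_1K_2,\dots,n_cK_2)=\max\{r+\delta,\,n_1\}+\sum_{i=1}^{c}(n_i-1)+1,$$ where $\delta=0$ if $\Sigma<\max\{n_1,2n_2\}$, $\Sigma$ is even and at least one $t_i$ is even, and $\delta=-1$ otherwise. (For $s=0$ one has $\Sigma=0$, $r=2$ and $\delta=-1$.) -/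

import Mathlib

/-- A simple graph bundled with its vertex type. -/
abbrev BundledGraph : Type 1 := Σ V : Type, SimpleGraph V

/-- `H → (G i)_{i : ι}`: for every partition of the edges of `H` into (possibly empty) colour
classes indexed by `ι`, some colour class `i` has a subgraph isomorphic to `G i`. -/
def Arrows {W : Type} (H : SimpleGraph W) {ι : Type} (G : ι → BundledGraph) : Prop :=
  ∀ C : H.EdgeLabeling ι, ∃ i : ι, (G i).2.IsContained (C.labelGraph i)

/-- The multicolour Ramsey number of the family `G`: the smallest positive integer `N` such that
`K_N → (G i)_{i : ι}`. -/
noncomputable def ramseyNumber {ι : Type} (G : ι → BundledGraph) : ℕ :=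
  sInf {N : ℕ | 0 < N ∧ Arrows (⊤ : SimpleGraph (Fin N)) G}

/-- The star `S_t` with `t` edges, i.e. `K_{1,t}`. -/
def star_S (t : ℕ) : BundledGraph :=
  ⟨Fin 1 ⊕ Fin t, completeBipartiteGraph (Fin 1) (Fin t)⟩

/-- The stripe `nK₂`: `n` pairwise disjoint edges `{(k, 0), (k, 1)}`, `k < n`. -/
def stripe (n : ℕ) : BundledGraph :=
  ⟨Fin n × Fin 2,
    { Adj := fun p q => p.1 = q.1 ∧ p.2 ≠ q.2
      symm := ⟨fun _ _ h => ⟨h.1.symm, h.2.symm⟩⟩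
      loopless := ⟨fun _ h => h.2 rfl⟩ }⟩

/-- The second entry `n₂` of a finite sequence `n₁, …, n_c`, read as `0` if there is none, so that
`max {n₁, 2n₂} = n₁` when `c = 1`. -/
def secondEntry {c : ℕ} (n : Fin c → ℕ) : ℕ :=
  if h : 1 < c then n ⟨1, h⟩ else 0

/-! Upper bound. In a colouring avoiding every star and stripe, Tutte–Berge
(`exists_tutteBerge_partition`) gives for each stripe colour `j` a set `U j` off which the colour
lies inside the classes of a partition. Delete all `U j` and let `b j` be what remains of `n j - 1`;
half the class sizes, rounded down, then sum to at most `b j`. On the remaining set `X` every pair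
has a star colour or lies in a common class, so each vertex needs class degrees totalling at least
`|X| - 1 - Σ`. In each colour at most one class `D j` has more than `b j + 1` elements, and an
excess there is paid for by every other class. The sets `D j` are too small to cover all pairs
(`card_lt_of_clique_cover`), and two vertices sharing no `D j` have average class degree at most `∑
b j`; hence `|X| ≤ Σ + 1 + ∑ b j` (`card_lt_of_partitions`). When `Σ` and some `t i` are even and `Σ
≥ max (n₁, 2n₂)`, one vertex can be saved: equality would make all excesses vanish by averaging,
then all `b j` vanish by parity (`injective_of_partitions`), leaving an odd complete graph with a
regular colour class of odd degree.

Lower bound. A colouring of a small complete graph is extended by vertices all of whose edges have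
one stripe colour (`not_arrows_of_extension`). The core is a monochromatic clique, a star-free
colouring, or two cliques sharing a vertex, the last being needed when `r = Σ + 1` and `n₁ ≤ Σ <
2n₂`. -/

open Finset

/-! ### Arrowing, and criteria for containing stars and stripes. -/

/-- Arrowing by complete graphs is monotone in the vertex set. -/
theorem Arrows.of_embedding {V W ι : Type} {G : ι → BundledGraph} (f : V ↪ W)
    (h : Arrows (⊤ : SimpleGraph V) G) : Arrows (⊤ : SimpleGraph W) G := by
  intro C
  obtain ⟨i, hi⟩ := h (SimpleGraph.TopEdgeLabeling.pullback C f)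
  refine ⟨i, hi.trans ⟨⟨⟨f, ?_⟩, f.injective⟩⟩⟩
  intro a b hab
  rw [SimpleGraph.TopEdgeLabeling.labelGraph_adj] at hab ⊢
  obtain ⟨hne, hc⟩ := hab
  exact ⟨f.injective.ne hne, hc⟩

theorem ramseyNumber_eq_succ {ι : Type} {G : ι → BundledGraph} {N : ℕ}
    (h₁ : Arrows (⊤ : SimpleGraph (Fin (N + 1))) G)
    (h₀ : ¬ Arrows (⊤ : SimpleGraph (Fin N)) G) : ramseyNumber G = N + 1 := by
  apply le_antisymm
  · exact Nat.sInf_le ⟨N.succ_pos, h₁⟩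
  · refine le_csInf ⟨N + 1, N.succ_pos, h₁⟩ ?_
    rintro M ⟨-, hM⟩
    by_contra! hlt
    exact h₀ (hM.of_embedding (Fin.castLEEmb (by omega)))

/-- The graph of the pairs of colour `i` under a symmetric colouring of the pairs of vertices. -/
def colorGraph {V ι : Type} (χ : V → V → ι) (hχ : ∀ x y, χ x y = χ y x) (i : ι) :
    SimpleGraph V where
  Adj x y := x ≠ y ∧ χ x y = i
  symm := ⟨fun x y h => ⟨h.1.symm, hχ x y ▸ h.2⟩⟩
  loopless := ⟨fun _ h => h.1 rfl⟩

/-- Lets colourings be total symmetric functions on any convenient vertex type; values on the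
diagonal play no role. -/
theorem not_arrows_of_coloring {V ι : Type} [Fintype V] {G : ι → BundledGraph} {N : ℕ}
    (hN : Fintype.card V = N) (χ : V → V → ι) (hχ : ∀ x y, χ x y = χ y x)
    (h : ∀ i, ¬ (G i).2.IsContained (colorGraph χ hχ i)) :
    ¬ Arrows (⊤ : SimpleGraph (Fin N)) G := by
  intro hA
  obtain ⟨i, hi⟩ := (hA.of_embedding (Fintype.equivFinOfCardEq hN).symm.toEmbedding)
    (SimpleGraph.EdgeLabeling.mk (fun x y _ => χ x y) (fun x y _ => hχ y x))
  refine h i (hi.trans (SimpleGraph.IsContained.of_le ?_))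
  intro x y hxy
  rw [SimpleGraph.TopEdgeLabeling.labelGraph_adj] at hxy
  obtain ⟨hne, hc⟩ := hxy
  exact ⟨hne, hc⟩

theorem star_isContained_iff {V : Type} [Fintype V] {t : ℕ} (H : SimpleGraph V)
    [DecidableRel H.Adj] : (star_S t).2.IsContained H ↔ ∃ v, t ≤ H.degree v := by
  classical
  constructor
  · rintro ⟨f⟩
    refine ⟨f (Sum.inl 0), ?_⟩
    have hsub : (univ.image fun i : Fin t => f (Sum.inr i)) ⊆ H.neighborFinset (f (Sum.inl 0)) := by
      intro x hx
      obtain ⟨i, -, rfl⟩ := mem_image.1 hx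
      rw [SimpleGraph.mem_neighborFinset]
      apply f.toHom.map_adj
      simp [star_S]
    have hinj : Function.Injective fun i : Fin t => f (Sum.inr i) :=
      fun i j hij => Sum.inr_injective (f.injective hij)
    have := card_le_card hsub
    rwa [card_image_of_injective _ hinj, card_univ,
      Fintype.card_fin, SimpleGraph.card_neighborFinset_eq_degree] at this
  · rintro ⟨v, hv⟩
    rw [← SimpleGraph.card_neighborFinset_eq_degree] at hv
    obtain ⟨g⟩ : Nonempty (Fin t ↪ H.neighborFinset v) :=
      Function.Embedding.nonempty_of_card_le (by rwa [Fintype.card_fin, Fintype.card_coe])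
    have hg : ∀ i, H.Adj v (g i) := fun i => (H.mem_neighborFinset _ _).1 (g i).2
    refine ⟨⟨⟨Sum.elim (fun _ => v) (fun i => g i), ?_⟩, ?_⟩⟩
    · rintro (a | a) (b | b) hab
      · simp [star_S] at hab
      · exact hg b
      · exact (hg a).symm
      · simp [star_S] at hab
    · rintro (a | a) (b | b) hab
      · exact congrArg Sum.inl (Subsingleton.elim a b)
      · exact absurd hab (hg b).ne
      · exact absurd hab (hg a).ne'
      · exact congrArg Sum.inr (g.injective (Subtype.ext hab))

/-- A weight on the vertices that is at least `2` on every edge bounds the size of a stripe. -/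
theorem two_mul_le_sum_of_stripe_isContained {V : Type} [Fintype V] {n : ℕ} {H : SimpleGraph V}
    (w : V → ℕ) (hw : ∀ x y, H.Adj x y → 2 ≤ w x + w y) (h : (stripe n).2.IsContained H) :
    2 * n ≤ ∑ v, w v := by
  obtain ⟨f⟩ := h
  let g : Fin n × Fin 2 ↪ V := ⟨f, f.injective⟩
  calc 2 * n = ∑ _k : Fin n, 2 := by simp [mul_comm]
    _ ≤ ∑ k : Fin n, ∑ e : Fin 2, w (g (k, e)) := by
        refine sum_le_sum fun k _ => ?_
        rw [Fin.sum_univ_two]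
        apply hw
        apply f.toHom.map_adj
        simp [stripe]
    _ = ∑ p : Fin n × Fin 2, w (g p) := (Fintype.sum_prod_type fun p => w (g p)).symm
    _ = ∑ v ∈ univ.map g, w v := by rw [sum_map]
    _ ≤ ∑ v, w v := sum_le_sum_of_subset (subset_univ _)

/-- An adjacency-compatible fixed point free involution of a finite set yields a stripe. -/
theorem stripe_isContained_of_involution {V : Type} [LinearOrder V] {n : ℕ} {H : SimpleGraph V}
    (T : Finset V) (σ : V → V) (hσT : ∀ x ∈ T, σ x ∈ T) (hσ : ∀ x ∈ T, σ (σ x) = x)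
    (hadj : ∀ x ∈ T, H.Adj x (σ x)) (hn : 2 * n ≤ #T) : (stripe n).2.IsContained H := by
  -- The order picks the smaller end of each pair `{x, σ x}`, so at least half of `T` is picked.
  have hle : #{x ∈ T | σ x < x} ≤ #{x ∈ T | x < σ x} := by
    refine card_le_card_of_injOn σ ?_ ?_
    · intro x hx
      simp only [coe_filter, Set.mem_ofPred_eq] at hx ⊢
      exact ⟨hσT x hx.1, by rw [hσ x hx.1]; exact hx.2⟩
    · intro x hx y hy hxy
      simp only [coe_filter, Set.mem_ofPred_eq] at hx hy
      rw [← hσ x hx.1, ← hσ y hy.1, hxy]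
  have hcard : #T = #{x ∈ T | x < σ x} + #{x ∈ T | σ x < x} := by
    rw [← card_filter_add_card_filter_not (s := T) (fun x => x < σ x)]
    congr 2
    apply filter_congr
    intro x hx
    have := (hadj x hx).ne'
    exact ⟨fun h => lt_of_le_of_ne (not_lt.1 h) this, fun h => not_lt.2 h.le⟩
  obtain ⟨g⟩ : Nonempty (Fin n ↪ {x // x ∈ ({x ∈ T | x < σ x} : Finset V)}) :=
    Function.Embedding.nonempty_of_card_le (by rw [Fintype.card_fin, Fintype.card_coe]; omega)
  have hgT : ∀ k, (g k : V) ∈ T := fun k => (mem_filter.1 (g k).2).1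
  have hg : ∀ k, (g k : V) < σ (g k) := fun k => (mem_filter.1 (g k).2).2
  have hne : ∀ k l, (g k : V) ≠ σ (g l) := by
    intro k l hkl
    have h1 := hg k
    rw [hkl, hσ _ (hgT l)] at h1
    exact lt_asymm h1 (hg l)
  refine ⟨⟨⟨fun p => if p.2 = 0 then g p.1 else σ (g p.1), ?_⟩, ?_⟩⟩
  · rintro ⟨k, a⟩ ⟨l, b⟩ ⟨hkl, hab⟩
    simp only at hkl hab
    subst hkl
    fin_cases a <;> fin_cases b
    · exact absurd rfl hab
    · simpa using hadj _ (hgT k)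
    · simpa using (hadj _ (hgT k)).symm
    · exact absurd rfl hab
  · rintro ⟨k, a⟩ ⟨l, b⟩ hab
    have key : (g k : V) = g l → k = l := fun h => g.injective (Subtype.ext h)
    fin_cases a <;> fin_cases b
    · exact Prod.ext (key (by simpa using hab)) rfl
    · exact absurd (by simpa using hab) (hne k l)
    · exact absurd (by simpa using hab.symm) (hne l k)
    · have h1 : σ (g k) = σ (g l) := by simpa using hab
      exact Prod.ext (key (by rw [← hσ _ (hgT k), ← hσ _ (hgT l), h1])) rfl

/-! ### The Tutte–Berge formula, derived from Tutte's theorem. -/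

theorem two_mul_sum_half_add_ncard_oddComponents {V : Type} [Fintype V] (G : SimpleGraph V)
    [Fintype G.ConnectedComponent] :
    2 * ∑ c : G.ConnectedComponent, c.supp.ncard / 2 + G.oddComponents.ncard = Fintype.card V := by
  classical
  have hodd : G.oddComponents.ncard = ∑ c : G.ConnectedComponent, c.supp.ncard % 2 := by
    have : G.oddComponents = ↑(univ.filter fun c : G.ConnectedComponent => Odd c.supp.ncard) := by
      simp [SimpleGraph.oddComponents]
    rw [this, Set.ncard_coe_finset, card_filter]
    refine sum_congr rfl fun c _ => ?_
    split_ifs with h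
    · exact (Nat.odd_iff.1 h).symm
    · exact (Nat.even_iff.1 (Nat.not_odd_iff_even.1 h)).symm
  rw [hodd, mul_sum, ← sum_add_distrib, ← card_univ (α := V),
    card_eq_sum_card_fiberwise (f := G.connectedComponentMk) (t := univ) (by simp)]
  refine sum_congr rfl fun c _ => ?_
  rw [Nat.div_add_mod, ← Set.ncard_coe_finset]
  congr 1
  ext v
  simp [SimpleGraph.ConnectedComponent.mem_supp_iff]

/-- The join of `H` with a complete graph on `k` vertices. -/
def joinComplete {V : Type} (H : SimpleGraph V) (k : ℕ) : SimpleGraph (V ⊕ Fin k) where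
  Adj x y := x ≠ y ∧ ∀ u v, x = Sum.inl u → y = Sum.inl v → H.Adj u v
  symm := ⟨fun _ _ h => ⟨h.1.symm, fun u v hu hv => (h.2 v u hv hu).symm⟩⟩
  loopless := ⟨fun _ h => h.1 rfl⟩

/-- At most `k` vertices of `V` are matched into the added clique; the other `2 * n` or more are
matched among themselves by edges of `H`. -/
theorem stripe_isContained_of_joinComplete_perfectMatching {V : Type} [Fintype V] [LinearOrder V]
    {H : SimpleGraph V} {k n : ℕ} (hcard : 2 * n + k ≤ Fintype.card V)
    (M : (joinComplete H k).Subgraph) (hM : M.IsPerfectMatching) : (stripe n).2.IsContained H := by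
  rw [SimpleGraph.Subgraph.isPerfectMatching_iff] at hM
  choose σ hσ huniq using hM
  simp only at hσ huniq
  have hσσ : ∀ x, σ (σ x) = x := fun x => (huniq _ _ (hσ x).symm).symm
  have hσadj : ∀ x, (joinComplete H k).Adj x (σ x) := fun x => (hσ x).adj_sub
  have hright : #{x : V | ¬ (σ (Sum.inl x)).isLeft} ≤ k := by
    calc #{x : V | ¬ (σ (Sum.inl x)).isLeft}
        ≤ #(univ.map (Function.Embedding.inr : Fin k ↪ V ⊕ Fin k)) := by
          refine card_le_card_of_injOn (fun x => σ (Sum.inl x)) ?_ ?_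
          · intro x hx
            simp only [coe_filter, mem_univ, true_and, Set.mem_ofPred_eq] at hx
            rcases h : σ (Sum.inl x) with y | y
            · simp [h] at hx
            · simp [h]
          · intro x _ y _ hxy
            apply Sum.inl_injective (β := Fin k)
            rw [← hσσ (Sum.inl x), ← hσσ (Sum.inl y)]
            exact congrArg σ hxy
      _ = k := by simp
  have hsplit := card_filter_add_card_filter_not (s := (univ : Finset V))
    (fun x => (σ (Sum.inl x)).isLeft = true)
  rw [card_univ] at hsplit
  have hτ : ∀ x : V, (σ (Sum.inl x)).isLeft = true →
      Sum.inl (Sum.elim id (fun _ => x) (σ (Sum.inl x))) = σ (Sum.inl x) := by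
    intro x hx
    rcases h : σ (Sum.inl x) with y | y
    · simp
    · simp [h] at hx
  refine stripe_isContained_of_involution {x : V | (σ (Sum.inl x)).isLeft}
    (fun x => Sum.elim id (fun _ => x) (σ (Sum.inl x))) ?_ ?_ ?_ (by omega)
  · intro x hx
    simp only [mem_filter, mem_univ, true_and] at hx ⊢
    rw [hτ x hx, hσσ]; rfl
  · intro x hx
    simp only [mem_filter, mem_univ, true_and] at hx ⊢
    rw [hτ x hx, hσσ]; rfl
  · intro x hx
    simp only [mem_filter, mem_univ, true_and] at hx
    exact (hσadj (Sum.inl x)).2 _ _ rfl (hτ x hx).symm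

/-- The hard direction of the Tutte–Berge formula: a graph without `a + 1` disjoint edges has a
vertex set `U` such that the classes of a partition of the remaining vertices into unions of
components certify this. -/
theorem exists_tutteBerge_partition {V : Type} [Fintype V] [LinearOrder V] (H : SimpleGraph V)
    (a : ℕ) (h : ¬ (stripe (a + 1)).2.IsContained H) :
    ∃ (U : Finset V) (L : Type) (_ : Fintype L) (_ : DecidableEq L) (p : V → L),
      (∀ x y, x ∉ U → y ∉ U → H.Adj x y → p x = p y) ∧
      #U + ∑ l : L, #{v | v ∉ U ∧ p v = l} / 2 ≤ a := by
  classical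
  -- A single class suffices for few vertices. Otherwise `k` is the number of vertices that a
  -- matching of `a + 1` edges leaves uncovered.
  by_cases hV : Fintype.card V ≤ 2 * a + 1
  · refine ⟨∅, Unit, inferInstance, inferInstance, fun _ => (), fun _ _ _ _ _ => rfl, ?_⟩
    simp only [card_empty, univ_unique, sum_singleton, notMem_empty, not_false_eq_true, and_self,
      filter_true, card_univ]
    omega
  obtain ⟨k, hk⟩ : ∃ k, Fintype.card V = 2 * (a + 1) + k := ⟨Fintype.card V - 2 * (a + 1), by omega⟩
  obtain ⟨u, hu⟩ : ∃ u, (joinComplete H k).IsTutteViolator u := by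
    by_contra! hno
    obtain ⟨M, hM⟩ := SimpleGraph.tutte.2 hno
    exact h (stripe_isContained_of_joinComplete_perfectMatching hk.ge M hM)
  unfold SimpleGraph.IsTutteViolator at hu
  set K := ((⊤ : (joinComplete H k).Subgraph).deleteVerts u) with hK
  have hmem : ∀ x, x ∈ K.verts ↔ x ∉ u := by simp [hK]
  have hKadj : ∀ x y : K.verts, K.coe.Adj x y ↔ (joinComplete H k).Adj x y := by
    intro x y
    have hx := (hmem x).1 x.2
    have hy := (hmem y).1 y.2
    simp [hK, hx, hy]
  have hsum := two_mul_sum_half_add_ncard_oddComponents K.coe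
  have hcard : Fintype.card K.verts + u.ncard = Fintype.card V + k := by
    have h1 : K.verts = uᶜ := by ext x; simp [hmem]
    have h2 := Set.ncard_add_ncard_compl u
    rw [← h1, ← Nat.card_coe_set_eq K.verts, Nat.card_eq_fintype_card, Nat.card_eq_fintype_card,
      Fintype.card_sum, Fintype.card_fin] at h2
    omega
  by_cases hall : ∀ j : Fin k, Sum.inr j ∈ u
  · have hin : ∀ v : V, Sum.inl v ∉ u → Sum.inl v ∈ K.verts := fun v hv => (hmem _).2 hv
    -- The label `none` only serves vertices of `U`, so its class contributes nothing.
    obtain ⟨p, hp⟩ : ∃ p : V → Option K.coe.ConnectedComponent, ∀ v (hv : Sum.inl v ∉ u),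
        p v = some (K.coe.connectedComponentMk ⟨Sum.inl v, hin v hv⟩) :=
      ⟨fun v => if hv : Sum.inl v ∉ u then
        some (K.coe.connectedComponentMk ⟨Sum.inl v, hin v hv⟩) else none,
        fun v hv => dif_pos hv⟩
    obtain ⟨U, hU⟩ : ∃ U : Finset V, ∀ v, v ∈ U ↔ Sum.inl v ∈ u :=
      ⟨univ.filter fun v => Sum.inl v ∈ u, by simp⟩
    refine ⟨U, Option K.coe.ConnectedComponent, inferInstance, inferInstance, p, ?_, ?_⟩
    · intro x y hx hy hxy
      rw [hU] at hx hy
      rw [hp x hx, hp y hy]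
      congr 1
      apply SimpleGraph.ConnectedComponent.sound
      apply SimpleGraph.Adj.reachable
      rw [hKadj]
      refine ⟨by simpa using hxy.ne, ?_⟩
      intro u v hu hv
      rw [← Sum.inl_injective hu, ← Sum.inl_injective hv]
      exact hxy
    · have hucard : u.ncard = #U + k := by
        have : u = ↑(U.disjSum (univ : Finset (Fin k))) := by
          ext (x | x) <;> simp [hall, hU]
        rw [this, Set.ncard_coe_finset, card_disjSum]
        simp
      have hnone : #{v | v ∉ U ∧ p v = none} = 0 := by
        rw [card_eq_zero, filter_eq_empty_iff]
        rintro v - ⟨hv, hpv⟩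
        rw [hU] at hv
        rw [hp v hv] at hpv
        cases hpv
      have hle : ∑ c : K.coe.ConnectedComponent, #{v | v ∉ U ∧ p v = some c} / 2 ≤
          ∑ c : K.coe.ConnectedComponent, c.supp.ncard / 2 := by
        refine sum_le_sum fun c _ => Nat.div_le_div_right ?_
        rw [← Set.ncard_coe_finset, ← Set.ncard_image_of_injective c.supp Subtype.val_injective]
        refine Set.ncard_le_ncard_of_injOn Sum.inl ?_ Sum.inl_injective.injOn (Set.toFinite _)
        intro v hv
        simp only [coe_filter, mem_univ, true_and, Set.mem_ofPred_eq, hU] at hv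
        refine ⟨⟨Sum.inl v, hin v hv.1⟩, ?_, rfl⟩
        have := hv.2
        rw [hp v hv.1] at this
        exact Option.some_injective _ this
      rw [Fintype.sum_option, hnone]
      omega
  -- A surviving clique vertex is adjacent to everything left, so there is at most one odd component
  -- and the violator is empty. That contradicts the even order `2 * (a + 1) + 2 * k` of the join.
  · push Not at hall
    obtain ⟨j, hj⟩ := hall
    have hjK : Sum.inr j ∈ K.verts := (hmem _).2 hj
    have hsub : K.coe.oddComponents ⊆ {K.coe.connectedComponentMk ⟨Sum.inr j, hjK⟩} := by
      intro c _
      rw [Set.mem_singleton_iff]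
      induction c using SimpleGraph.ConnectedComponent.ind with
      | h x =>
        by_cases hx : x = ⟨Sum.inr j, hjK⟩
        · rw [hx]
        · apply SimpleGraph.ConnectedComponent.sound
          apply SimpleGraph.Adj.reachable
          rw [hKadj]
          refine ⟨fun h => hx (Subtype.ext h), ?_⟩
          intro u v _ hv
          simp at hv
    have h1 := Set.ncard_le_ncard hsub (Set.toFinite _)
    rw [Set.ncard_singleton] at h1
    omega

/-! ### Counting with partitions into few classes. -/

/-- If every class of a partition contributes half its size, rounded down, to a total of at most
`b`, then at most one class `D` has more than `b + 1` elements; the excess `e` of its size over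
`b + 1` forces all other classes to fall below `b + 1` by `e` at least. -/
theorem exists_dominant_class {V L : Type} [Fintype V] [Fintype L] [DecidableEq L] (p : V → L)
    (b : ℕ) (hb : ∑ l, #{v | p v = l} / 2 ≤ b) :
    ∃ (D : Finset V) (e : ℕ), e ≤ b ∧ (e = 0 → D = ∅) ∧ (0 < e → #D = e + b + 1) ∧
      (∀ v ∈ D, #{w | p w = p v} = e + b + 1) ∧ (∀ v ∉ D, #{w | p w = p v} + e ≤ b + 1) := by
  by_cases h : ∃ v, b + 2 ≤ #{w | p w = p v}
  · obtain ⟨v, hv⟩ := h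
    have h1 : #{w | p w = p v} / 2 ≤ b :=
      (single_le_sum (f := fun l => #{w | p w = l} / 2) (fun _ _ => Nat.zero_le _)
        (mem_univ (p v))).trans hb
    refine ⟨({w | p w = p v} : Finset V), #{w | p w = p v} - (b + 1), by omega, by omega,
      by omega, ?_, ?_⟩
    · intro w hw
      rw [mem_filter] at hw
      rw [hw.2]
      omega
    · intro w hw
      have hne : p v ≠ p w := fun h => hw (by simp [h])
      -- Even with the rounding, this bounds the two sizes together by `2 * b + 2`.
      have h2 : #{x | p x = p v} / 2 + #{x | p x = p w} / 2 ≤ b := by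
        rw [← sum_pair (f := fun l => #{x | p x = l} / 2) hne]
        exact (sum_le_sum_of_subset (subset_univ _)).trans hb
      omega
  · push Not at h
    refine ⟨∅, 0, Nat.zero_le _, fun _ => rfl, fun h => absurd h (lt_irrefl _), by simp, ?_⟩
    intro v _
    have := h v
    omega

/-- A complete graph covered by cliques of at most `2 b i + 1` vertices is small. -/
theorem card_lt_of_clique_cover {V ι : Type} [Fintype V] [DecidableEq V] [Fintype ι]
    (D : ι → Finset V) (b : ι → ℕ) (M : ℕ) (hD : ∀ i, #(D i) ≤ 2 * b i + 1) (hM : ∀ i, b i ≤ M)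
    (hcov : ∀ v w, v ≠ w → ∃ i, v ∈ D i ∧ w ∈ D i) :
    Fintype.card V < M + 2 + ∑ i, b i := by
  by_contra! hN
  have hsub : (univ : Finset V).offDiag ⊆ univ.biUnion fun i => (D i).offDiag := by
    rintro ⟨v, w⟩ hvw
    obtain ⟨i, hv, hw⟩ := hcov v w (mem_offDiag.1 hvw).2.2
    exact mem_biUnion.2 ⟨i, mem_univ _, mem_offDiag.2 ⟨hv, hw, (mem_offDiag.1 hvw).2.2⟩⟩
  have h1 := (card_le_card hsub).trans card_biUnion_le
  simp only [offDiag_card, card_univ] at h1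
  have h2 : ∑ i, (#(D i) * #(D i) - #(D i)) ≤ ∑ i, (2 * M + 1) * (2 * b i) := by
    refine sum_le_sum fun i _ => ?_
    rw [← Nat.mul_sub_one]
    exact Nat.mul_le_mul ((hD i).trans (by have := hM i; omega)) (by have := hD i; omega)
  rw [← mul_sum, ← mul_sum] at h2
  have h3 := h1.trans h2
  generalize Fintype.card V = N at *
  generalize ∑ i, b i = B at *
  -- The count of ordered pairs fails because `(M + B) ^ 2 ≥ 4 * M * B`.
  obtain ⟨x, rfl⟩ : ∃ x, N = M + 2 + B + x := ⟨N - (M + 2 + B), by omega⟩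
  rw [← Nat.mul_sub_one, show M + 2 + B + x - 1 = M + 1 + B + x by omega] at h3
  zify at h3
  have hx : (0 : ℤ) ≤ x := by positivity
  have hM0 : (0 : ℤ) ≤ M := by positivity
  have hB0 : (0 : ℤ) ≤ B := by positivity
  nlinarith [sq_nonneg ((M : ℤ) - B), mul_nonneg hx hM0, mul_nonneg hx hB0, mul_nonneg hx hx]

/-- A weighting by excesses `e` in which no colour has more than half of the total weight cannot
have nonnegative average. -/
theorem excess_eq_zero {ι : Type} [Fintype ι] [DecidableEq ι] (i₀ : ι) (e b : ι → ℤ) (S : ℤ)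
    (he : ∀ i, 0 ≤ e i) (heb : ∀ i, e i ≤ b i) (hhalf : ∀ i, 2 * e i ≤ ∑ j, e j)
    (hS : ∀ i, i ≠ i₀ → 2 * b i + 2 ≤ S)
    (h : 0 ≤ ∑ i, e i * (2 * (e i + b i + 1) - (S + 1 + ∑ j, b j))) : ∀ i, e i = 0 := by
  have hb : ∀ i, 0 ≤ b i := fun i => (he i).trans (heb i)
  have hEsplit := add_sum_erase univ e (mem_univ i₀)
  have hBsplit := add_sum_erase univ b (mem_univ i₀)
  have hle : ∑ i ∈ univ.erase i₀, e i ≤ ∑ i ∈ univ.erase i₀, b i := sum_le_sum fun i _ => heb i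
  rw [← add_sum_erase univ _ (mem_univ i₀)] at h
  set P := max (2 * (e i₀ + b i₀ + 1) - (S + 1 + ∑ j, b j)) 0 with hP
  have hP0 : 0 ≤ P := le_max_right _ _
  have hi₀ := hhalf i₀
  have hb₀ := hb i₀
  have he₀ := he i₀
  have heb₀ := heb i₀
  -- For `i ≠ i₀` the factor of `e i` is at most `-1`, and so is its sum with the factor of `e i₀`.
  -- As `e i₀` is at most the sum of the other excesses, a positive term at `i₀` is outweighed.
  have hterm : ∀ i ∈ univ.erase i₀,
      e i * (2 * (e i + b i + 1) - (S + 1 + ∑ j, b j)) ≤ e i * (-(P + 1)) := by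
    intro i hi
    refine mul_le_mul_of_nonneg_left ?_ (he i)
    have h1 := hS i (ne_of_mem_erase hi)
    have h2 := hhalf i
    have h3 := heb i
    rcases max_cases (2 * (e i₀ + b i₀ + 1) - (S + 1 + ∑ j, b j)) 0 with h4 | h4 <;>
      rw [hP, h4.1] <;> linarith
  have hsum := sum_le_sum hterm
  rw [← sum_mul] at hsum
  have hfirst : e i₀ * (2 * (e i₀ + b i₀ + 1) - (S + 1 + ∑ j, b j)) ≤ e i₀ * P :=
    mul_le_mul_of_nonneg_left (le_max_left _ _) he₀
  have hlast : e i₀ * P ≤ (∑ i ∈ univ.erase i₀, e i) * P :=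
    mul_le_mul_of_nonneg_right (by linarith) hP0
  have hzero : ∑ i ∈ univ.erase i₀, e i ≤ 0 := by nlinarith
  have hE : ∑ j, e j ≤ 0 := by linarith
  intro i
  have := hhalf i
  have := he i
  linarith

/-- There are at least two classes of size `b + 1`. For odd `b` two of them already contribute `b +
1`; for even `b > 0` three contribute `3 * b / 2 > b`. -/
theorem even_of_uniform_classes {V L : Type} [Fintype V] [Fintype L] [DecidableEq L] (p : V → L) (b : ℕ)
    (hb : ∑ l, #{v | p v = l} / 2 ≤ b) (hsz : ∀ v, #{w | p w = p v} = b + 1)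
    (hV : b + 1 < Fintype.card V) (hb0 : 0 < b) : Even b ∧ Fintype.card V = 2 * (b + 1) := by
  set T := univ.image p with hT
  have hcls : ∀ l ∈ T, #{v | p v = l} = b + 1 := by
    intro l hl
    obtain ⟨v, -, rfl⟩ := mem_image.1 hl
    exact hsz v
  have h1 : Fintype.card V = #T * (b + 1) := by
    rw [← card_univ, card_eq_sum_card_fiberwise (f := p) (t := T)
      (fun v hv => mem_coe.2 (mem_image_of_mem p hv)), sum_congr rfl hcls, sum_const, smul_eq_mul]
  have h2 : #T * ((b + 1) / 2) ≤ b := by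
    calc #T * ((b + 1) / 2) = ∑ l ∈ T, #{v | p v = l} / 2 := by
          rw [sum_congr rfl fun l hl => by rw [hcls l hl], sum_const, smul_eq_mul]
      _ ≤ b := (sum_le_sum_of_subset (subset_univ _)).trans hb
  have h3 : 2 ≤ #T := by
    by_contra! h
    have : #T * (b + 1) ≤ 1 * (b + 1) := Nat.mul_le_mul_right _ (by omega)
    omega
  have h4 : Even b := by
    by_contra hodd
    rw [Nat.not_even_iff_odd] at hodd
    obtain ⟨m, rfl⟩ := hodd
    have := Nat.mul_le_mul_right ((2 * m + 1 + 1) / 2) h3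
    omega
  refine ⟨h4, ?_⟩
  have h5 : #T = 2 := by
    by_contra h
    have := Nat.mul_le_mul_right ((b + 1) / 2) (show 3 ≤ #T by omega)
    obtain ⟨m, rfl⟩ := h4
    omega
  rw [h1, h5]

section Core

variable {V ι : Type} [Fintype V] [DecidableEq V] [Fintype ι] {L : ι → Type}
  [∀ i, Fintype (L i)] [∀ i, DecidableEq (L i)]

/-- The vertices cannot be partitioned in several ways into few classes so that almost all pairs
of vertices lie in a common class. -/
theorem card_lt_of_partitions (p : ∀ i, V → L i) (b : ι → ℕ) (S M : ℕ)
    (hb : ∀ i, ∑ l, #{v | p i v = l} / 2 ≤ b i) (hM : ∀ i, b i ≤ M)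
    (hdeg : ∀ v, Fintype.card V ≤ S + 1 + ∑ i, (#{w | p i w = p i v} - 1))
    (hV : M + 2 + ∑ i, b i ≤ Fintype.card V) : Fintype.card V < S + 2 + ∑ i, b i := by
  by_contra! hN
  choose D e heb hD0 hDe hin hout using fun i => exists_dominant_class (p i) (b i) (hb i)
  have hD : ∀ i, #(D i) ≤ 2 * b i + 1 := by
    intro i
    rcases Nat.eq_zero_or_pos (e i) with h | h
    · simp [hD0 i h]
    · have := hDe i h; have := heb i; omega
  refine absurd (card_lt_of_clique_cover D b M hD hM ?_) (not_lt.2 hV)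
  intro v w _
  by_contra! hno
  -- At most one of `v`, `w` gains the excess `e i`, and then the other loses at least as much.
  have hle : ∀ i, (#{x | p i x = p i v} - 1) + (#{x | p i x = p i w} - 1) ≤ 2 * b i := by
    intro i
    have hi := heb i
    by_cases hv : v ∈ D i
    · have := hin i v hv; have := hout i w (hno i hv); omega
    · have := hout i v hv
      by_cases hw : w ∈ D i
      · have := hin i w hw; omega
      · have := hout i w hw; omega
  have hsum := sum_le_sum fun i (_ : i ∈ (univ : Finset ι)) => hle i
  rw [sum_add_distrib, ← mul_sum] at hsum
  have := hdeg v
  have := hdeg w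
  omega

/-- In the extremal case of `card_lt_of_partitions`, parity forces all classes to be trivial. -/
theorem injective_of_partitions [DecidableEq ι] (p : ∀ i, V → L i) (b : ι → ℕ) (S M : ℕ) (i₀ : ι)
    (hb : ∀ i, ∑ l, #{v | p i v = l} / 2 ≤ b i) (hM : ∀ i, b i ≤ M)
    (hdeg : ∀ v, Fintype.card V ≤ S + 1 + ∑ i, (#{w | p i w = p i v} - 1))
    (hV : Fintype.card V = S + 1 + ∑ i, b i) (hSeven : Even S) (hMS : M + 1 ≤ S)
    (hS : ∀ i, i ≠ i₀ → 2 * b i + 2 ≤ S) :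
    (∀ i, b i = 0) ∧ ∀ i, Function.Injective (p i) := by
  choose D e heb hD0 hDe hin hout using fun i => exists_dominant_class (p i) (b i) (hb i)
  have hD : ∀ i, #(D i) ≤ 2 * b i + 1 := by
    intro i
    rcases Nat.eq_zero_or_pos (e i) with h | h
    · simp [hD0 i h]
    · have := hDe i h; have := heb i; omega
  -- In the extremal case the class degrees at `v` sum to at least `∑ b i`, so the signed deviations
  -- from `b i` cannot have negative total.
  have hε : ∀ v, (0 : ℤ) ≤ ∑ i, if v ∈ D i then (e i : ℤ) else -e i := by
    intro v
    have hle : ∑ i, ((#{w | p i w = p i v} - 1 : ℕ) : ℤ) ≤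
        ∑ i, ((b i : ℤ) + if v ∈ D i then (e i : ℤ) else -e i) := by
      refine sum_le_sum fun i _ => ?_
      have := heb i
      split_ifs with h
      · have := hin i v h; omega
      · have := hout i v h; omega
    rw [sum_add_distrib] at hle
    have h1 := hdeg v
    rw [hV] at h1
    zify at h1
    linarith
  have he0 : ∀ i, (e i : ℤ) = 0 := by
    by_cases hcov : ∀ v w, v ≠ w → ∃ i, v ∈ D i ∧ w ∈ D i
    · have := card_lt_of_clique_cover D b M hD hM hcov
      omega
    push Not at hcov
    obtain ⟨v, w, -, hvw⟩ := hcov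
    -- At a vertex outside `D i` the loss `e i` is balanced by the other colours. Every `D i` misses
    -- `v` or `w`.
    have hhalf' : ∀ i x, x ∉ D i → 2 * (e i : ℤ) ≤ ∑ j, (e j : ℤ) := by
      intro i x hx
      have h1 := hε x
      rw [← add_sum_erase univ _ (mem_univ i), if_neg hx] at h1
      rw [← add_sum_erase univ _ (mem_univ i)]
      have h2 : ∑ j ∈ univ.erase i, (if x ∈ D j then (e j : ℤ) else -e j) ≤
          ∑ j ∈ univ.erase i, (e j : ℤ) := by
        refine sum_le_sum fun j _ => ?_
        split_ifs <;> omega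
      linarith
    have hhalf : ∀ i, 2 * (e i : ℤ) ≤ ∑ j, (e j : ℤ) := fun i => by
      by_cases hv : v ∈ D i
      · exact hhalf' i w (hvw i hv)
      · exact hhalf' i v hv
    refine excess_eq_zero i₀ (fun i => (e i : ℤ)) (fun i => (b i : ℤ)) S (fun i => by positivity)
      (fun i => by exact_mod_cast heb i) hhalf (fun i hi => by exact_mod_cast hS i hi) ?_
    -- Summed over all vertices, colour `i` gives `e i * (2 * #(D i) - |V|)`.
    have hdouble := sum_nonneg fun v (_ : v ∈ (univ : Finset V)) => hε v
    rw [sum_comm] at hdouble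
    refine hdouble.trans_eq (sum_congr rfl fun i _ => ?_)
    have h1 : ∀ v, (if v ∈ D i then (e i : ℤ) else -e i) =
        (if v ∈ D i then 2 * (e i : ℤ) else 0) - e i := by
      intro v
      split_ifs <;> ring
    rw [sum_congr rfl fun v _ => h1 v, sum_sub_distrib, sum_ite_mem, univ_inter, sum_const,
      sum_const, card_univ, hV]
    rcases Nat.eq_zero_or_pos (e i) with h | h
    · simp [h]
    · rw [hDe i h]
      simp only [nsmul_eq_mul]
      push_cast
      ring
  have hle : ∀ i v, #{w | p i w = p i v} ≤ b i + 1 := by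
    intro i v
    have h1 : e i = 0 := by exact_mod_cast he0 i
    have h2 : v ∉ D i := by simp [hD0 i h1]
    have := hout i v h2
    omega
  have hsz : ∀ i v, #{w | p i w = p i v} = b i + 1 := by
    intro i v
    have h1 := hdeg v
    have h2 : ∀ j ∈ univ, #{w | p j w = p j v} - 1 ≤ b j := fun j _ => by
      have := hle j v; omega
    have h3 := (sum_eq_sum_iff_of_le h2).1 (le_antisymm (sum_le_sum h2) (by omega)) i (mem_univ i)
    have h4 : 0 < #{w | p i w = p i v} := card_pos.2 ⟨v, by simp⟩
    omega
  have hbi : ∀ i, b i ≤ ∑ j, b j := fun i =>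
    single_le_sum (f := b) (fun _ _ => Nat.zero_le _) (mem_univ i)
  have hparity : ∀ i, 0 < b i → Even (b i) ∧ Fintype.card V = 2 * (b i + 1) := fun i hi =>
    even_of_uniform_classes (p i) (b i) (hb i) (hsz i) (by have := hbi i; omega) hi
  -- A positive `b i` would make `|V|` even, while all `b j` and `S` are even and `|V| = S + 1 + ∑ b
  -- j` is odd.
  have hzero : ∀ i, b i = 0 := by
    by_contra! h
    obtain ⟨i, hi⟩ := h
    have h1 := (hparity i (Nat.pos_of_ne_zero hi)).2
    have h2 : Even (∑ j, b j) := by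
      refine even_sum _ fun j _ => ?_
      rcases Nat.eq_zero_or_pos (b j) with h | h
      · simp [h]
      · exact (hparity j h).1
    obtain ⟨x, hx⟩ := h2
    obtain ⟨y, hy⟩ := hSeven
    omega
  refine ⟨hzero, fun i v w hvw => ?_⟩
  have h1 := hsz i w
  rw [hzero i, zero_add, card_eq_one] at h1
  obtain ⟨z, hz⟩ := h1
  have hv : v ∈ ({z} : Finset V) := hz ▸ (by simp [hvw])
  have hw : w ∈ ({z} : Finset V) := hz ▸ (by simp)
  rw [mem_singleton.1 hv, mem_singleton.1 hw]

end Core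

/-! ### The upper bound. -/

theorem card_le_sum_degree_add_sum_class {V κ ι : Type} [Fintype V] [DecidableEq V] [Fintype κ]
    [Fintype ι] {L : ι → Type} [∀ i, DecidableEq (L i)] (G : κ → SimpleGraph V)
    [∀ k, DecidableRel (G k).Adj] (p : ∀ i, V → L i)
    (hcov : ∀ x y, x ≠ y → (∃ k, (G k).Adj x y) ∨ ∃ i, p i x = p i y) (v : V) :
    Fintype.card V ≤ ∑ k, (G k).degree v + 1 + ∑ i, (#{w | p i w = p i v} - 1) := by
  have hsub : univ.erase v ⊆ (univ.biUnion fun k => (G k).neighborFinset v) ∪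
      univ.biUnion fun i => ({w | p i w = p i v} : Finset V).erase v := by
    intro w hw
    have hne := ne_of_mem_erase hw
    rw [mem_union, mem_biUnion, mem_biUnion]
    rcases hcov v w hne.symm with ⟨k, hk⟩ | ⟨i, hi⟩
    · exact Or.inl ⟨k, mem_univ _, by simpa using hk⟩
    · exact Or.inr ⟨i, mem_univ _, by simp [hne, hi]⟩
  have h1 := (card_le_card hsub).trans
    ((card_union_le _ _).trans (Nat.add_le_add card_biUnion_le card_biUnion_le))
  rw [card_erase_of_mem (mem_univ v), card_univ] at h1
  simp only [SimpleGraph.card_neighborFinset_eq_degree] at h1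
  rw [sum_congr rfl fun i _ => card_erase_of_mem (s := ({w | p i w = p i v} : Finset V))
    (a := v) (by simp)] at h1
  omega

theorem card_le_sum_degree_add_one {V κ : Type} [Fintype V] [DecidableEq V] [Fintype κ]
    (G : κ → SimpleGraph V) [∀ k, DecidableRel (G k).Adj]
    (hcov : ∀ x y, x ≠ y → ∃ k, (G k).Adj x y) (v : V) :
    Fintype.card V ≤ ∑ k, (G k).degree v + 1 := by
  simpa using card_le_sum_degree_add_sum_class (ι := Empty) (L := fun _ => Unit) G
    (fun _ _ => ()) (fun x y hxy => Or.inl (hcov x y hxy)) v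

/-- An odd complete graph is not the union of graphs of degrees at most `t i - 1` that sum up to
the degree of the complete graph if some `t i - 1` is odd. -/
theorem not_cover_of_even_sum {V κ : Type} [Fintype V] [DecidableEq V] [Fintype κ] (t : κ → ℕ)
    (ht : ∀ k, 0 < t k) (G : κ → SimpleGraph V) [∀ k, DecidableRel (G k).Adj]
    (hcov : ∀ x y, x ≠ y → ∃ k, (G k).Adj x y) (hdeg : ∀ k v, (G k).degree v < t k)
    (hV : Fintype.card V = ∑ k, (t k - 1) + 1) (hS : Even (∑ k, (t k - 1))) :
    ¬ ∃ k, Even (t k) := by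
  rintro ⟨k, hk⟩
  -- The degree bounds sum exactly to `|V| - 1`, so each is attained and `G k` is regular of odd
  -- degree on an odd number of vertices.
  have heq : ∀ v, (G k).degree v = t k - 1 := by
    intro v
    have h1 := card_le_sum_degree_add_one G hcov v
    rw [hV] at h1
    have h2 : ∀ j ∈ univ, (G j).degree v ≤ t j - 1 := fun j _ => by have := hdeg j v; omega
    exact (sum_eq_sum_iff_of_le h2).1 (le_antisymm (sum_le_sum h2) (by omega)) k (mem_univ k)
  have h3 := (G k).even_card_odd_degree_vertices
  rw [filter_true_of_mem, card_univ, hV] at h3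
  · exact (Nat.not_even_iff_odd.2 hS.add_one) h3
  · intro v _
    rw [heq v]
    obtain ⟨m, hm⟩ := hk
    have := ht k
    exact ⟨m - 1, by omega⟩

/-- The consequences of the Tutte–Berge formula for a colouring that contains none of the given
stripes: after removing some vertices, the colours of the stripes become unions of few small
components. -/
theorem exists_partitions_of_not_contained {κ : Type} {N c : ℕ} (n : Fin c → ℕ)
    (hn : ∀ j, 0 < n j) (G : κ → SimpleGraph (Fin N)) (H : Fin c → SimpleGraph (Fin N))
    (hcov : ∀ x y, x ≠ y → (∃ i, (G i).Adj x y) ∨ ∃ j, (H j).Adj x y)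
    (hH : ∀ j, ¬ (stripe (n j)).2.IsContained (H j)) :
    ∃ (X : Finset (Fin N)) (b : Fin c → ℕ) (L : Fin c → Type) (_ : ∀ j, Fintype (L j))
      (_ : ∀ j, DecidableEq (L j)) (p : ∀ j, X → L j),
      (∀ j, b j ≤ n j - 1) ∧ N + ∑ j, b j ≤ #X + ∑ j, (n j - 1) ∧
      (∀ j, ∑ l, #{v | p j v = l} / 2 ≤ b j) ∧
      (∀ x y : X, x ≠ y → (∃ i, ((G i).comap Subtype.val).Adj x y) ∨ ∃ j, p j x = p j y) := by
  have hH' : ∀ j, ¬ (stripe (n j - 1 + 1)).2.IsContained (H j) := fun j => by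
    rw [Nat.sub_add_cancel (hn j)]; exact hH j
  choose U L hL hL' p hp hU using fun j => exists_tutteBerge_partition (H j) (n j - 1) (hH' j)
  refine ⟨univ.filter fun v => ∀ j, v ∉ U j, fun j => n j - 1 - #(U j), L, hL, hL',
    fun j v => p j v, fun j => Nat.sub_le _ _, ?_, ?_, ?_⟩
  · have h1 : #(univ.filter fun v : Fin N => ¬ ∀ j, v ∉ U j) ≤ ∑ j, #(U j) := by
      refine (card_le_card ?_).trans (card_biUnion_le (s := univ) (t := U))
      intro v hv
      simpa using hv
    have h2 := card_filter_add_card_filter_not (s := (univ : Finset (Fin N)))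
      (fun v => ∀ j, v ∉ U j)
    rw [card_univ, Fintype.card_fin] at h2
    have h3 : ∑ j, (n j - 1 - #(U j)) + ∑ j, #(U j) = ∑ j, (n j - 1) := by
      rw [← sum_add_distrib]
      refine sum_congr rfl fun j _ => Nat.sub_add_cancel ?_
      have := hU j
      omega
    beta_reduce
    omega
  · intro j
    refine (sum_le_sum (g := fun l => #{v | v ∉ U j ∧ p j v = l} / 2) fun l _ =>
      Nat.div_le_div_right ?_).trans (by have := hU j; beta_reduce; omega)
    refine card_le_card_of_injOn Subtype.val ?_ Subtype.val_injective.injOn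
    rintro ⟨v, hv⟩ hvl
    simp only [mem_filter, mem_univ, true_and, coe_filter, Set.mem_ofPred_eq] at hv hvl ⊢
    exact ⟨hv j, hvl⟩
  · rintro ⟨x, hx⟩ ⟨y, hy⟩ hxy
    have hne : x ≠ y := fun h => hxy (Subtype.ext h)
    simp only [mem_filter, mem_univ, true_and] at hx hy
    rcases hcov x y hne with h | ⟨j, hj⟩
    · exact Or.inl h
    · exact Or.inr ⟨j, hp j x y (hx j) (hy j) hj⟩

theorem exists_labelGraph_adj {N : ℕ} {ι : Type} (C : (⊤ : SimpleGraph (Fin N)).EdgeLabeling ι)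
    {x y : Fin N} (hxy : x ≠ y) : ∃ i, (C.labelGraph i).Adj x y :=
  ⟨C.get x y hxy, (SimpleGraph.TopEdgeLabeling.labelGraph_adj x y).2 ⟨hxy, rfl⟩⟩

theorem degree_lt_of_not_isContained {V : Type} [Fintype V] {t : ℕ} {H : SimpleGraph V}
    [DecidableRel H.Adj] (h : ¬ (star_S t).2.IsContained H) (v : V) : H.degree v < t := by
  by_contra! hv
  exact h ((star_isContained_iff H).2 ⟨v, hv⟩)

/-- The upper bound for stars versus stripes. -/
theorem arrows_star_stripe {s c N : ℕ} (t : Fin s → ℕ) (n : Fin c → ℕ) (ht : ∀ i, 0 < t i)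
    (hn : ∀ j, 0 < n j) (m : ℕ) (hm : ∀ j, n j ≤ m) (j₀ : Fin c)
    (hN : m + ∑ j, (n j - 1) + 1 ≤ N)
    (h : ∑ i, (t i - 1) + 1 + ∑ j, (n j - 1) + 1 ≤ N ∨
      (∑ i, (t i - 1) + ∑ j, (n j - 1) + 1 ≤ N ∧ Even (∑ i, (t i - 1)) ∧ (∃ i, Even (t i)) ∧
        m ≤ ∑ i, (t i - 1) ∧ ∀ j, j ≠ j₀ → 2 * n j ≤ ∑ i, (t i - 1))) :
    Arrows (⊤ : SimpleGraph (Fin N))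
      (Sum.elim (fun i => star_S (t i)) (fun j => stripe (n j))) := by
  classical
  intro C
  by_contra hC
  have hstar : ∀ i, ¬ (star_S (t i)).2.IsContained (C.labelGraph (Sum.inl i)) :=
    fun i hi => hC ⟨Sum.inl i, hi⟩
  have hstripe : ∀ j, ¬ (stripe (n j)).2.IsContained (C.labelGraph (Sum.inr j)) :=
    fun j hj => hC ⟨Sum.inr j, hj⟩
  obtain ⟨X, b, L, _, _, p, hbn, hX, hb, hcov⟩ := exists_partitions_of_not_contained n hn
    (fun i => C.labelGraph (Sum.inl i)) (fun j => C.labelGraph (Sum.inr j)) (fun x y hxy => by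
      obtain ⟨i | j, hij⟩ := exists_labelGraph_adj C hxy
      · exact Or.inl ⟨i, hij⟩
      · exact Or.inr ⟨j, hij⟩) hstripe
  have hdlt : ∀ i v, ((C.labelGraph (Sum.inl i)).comap (Subtype.val : X → Fin N)).degree v < t i :=
    fun i v => degree_lt_of_not_isContained (fun hs => hstar i
      (hs.trans (SimpleGraph.Embedding.comap (Function.Embedding.subtype _) _).isContained)) v
  have hdeg : ∀ v, Fintype.card X ≤ ∑ i, (t i - 1) + 1 + ∑ j, (#{w | p j w = p j v} - 1) := by
    intro v
    have h1 := card_le_sum_degree_add_sum_class _ p hcov v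
    have h2 : ∑ i, ((C.labelGraph (Sum.inl i)).comap (Subtype.val : X → Fin N)).degree v ≤
        ∑ i, (t i - 1) := sum_le_sum fun i _ => by have := hdlt i v; omega
    omega
  have hbm : ∀ j, b j ≤ m - 1 := fun j => by have := hbn j; have := hm j; omega
  have hm0 : 0 < m := (hn j₀).trans_le (hm j₀)
  have hXcard : Fintype.card X = #X := Fintype.card_coe X
  -- The assumption `hN` survives the deletion as `m + 1 + ∑ b j ≤ |X|`, which excludes a cover by
  -- dominant classes.
  have hlt := card_lt_of_partitions p b (∑ i, (t i - 1)) (m - 1) hb hbm hdeg (by omega)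
  rcases h with h | ⟨h, hSeven, heven, hmS, hS⟩
  · omega
  · obtain ⟨hb0, hinj⟩ := injective_of_partitions p b (∑ i, (t i - 1)) (m - 1) j₀ hb hbm hdeg
      (by omega) hSeven (by omega)
      (fun j hj => by have := hS j hj; have := hbn j; have := hn j; omega)
    refine not_cover_of_even_sum t ht
      (fun i => (C.labelGraph (Sum.inl i)).comap (Subtype.val : X → Fin N)) ?_ hdlt ?_ hSeven heven
    · intro x y hxy
      rcases hcov x y hxy with h | ⟨j, hj⟩
      · exact h
      · exact absurd (hinj j hj) hxy
    · have : ∑ j, b j = 0 := sum_eq_zero fun j _ => hb0 j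
      omega

/-! ### The Ramsey number of stars. -/

/-- Distributes the factors of a factorization among the star colours, each within its capacity. -/
theorem exists_map_card_fiber_le {K κ : Type} [Fintype K] [Fintype κ] [DecidableEq κ] (u : κ → ℕ)
    (h : Fintype.card K ≤ ∑ i, u i) : ∃ f : K → κ, ∀ i, #{k | f k = i} ≤ u i := by
  obtain ⟨g⟩ : Nonempty (K ↪ Σ i, Fin (u i)) :=
    Function.Embedding.nonempty_of_card_le (by simpa using h)
  refine ⟨fun k => (g k).1, fun i => ?_⟩
  rw [← Fintype.card_fin (u i), ← card_univ,
    ← card_map (Function.Embedding.sigmaMk (β := fun i => Fin (u i)) i)]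
  refine card_le_card_of_injOn g ?_ g.injective.injOn
  intro k hk
  simp only [coe_filter, mem_univ, true_and, Set.mem_ofPred_eq] at hk
  subst hk
  exact mem_coe.2 (mem_map.2 ⟨(g k).2, mem_univ _, rfl⟩)

theorem not_star_isContained_colorGraph {V ι : Type} [Fintype V] [DecidableEq V] [DecidableEq ι]
    {χ : V → V → ι} {hχ : ∀ x y, χ x y = χ y x} {i : ι} {t : ℕ}
    (h : ∀ x, #{y | y ≠ x ∧ χ x y = i} < t) :
    ¬ (star_S t).2.IsContained (colorGraph χ hχ i) := by
  classical
  rw [star_isContained_iff]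
  rintro ⟨x, hx⟩
  refine absurd (h x) (not_lt.2 (hx.trans_eq ?_))
  rw [← SimpleGraph.card_neighborFinset_eq_degree]
  congr 1
  ext y
  rw [SimpleGraph.mem_neighborFinset, mem_filter]
  simp [colorGraph, ne_comm]

/-- Merging the colours of an edge colouring in which every vertex has at most `q` neighbours of
each colour. -/
theorem not_arrows_star_of_coloring {V K : Type} [Fintype V] [DecidableEq V] [Fintype K]
    [DecidableEq K] {s N : ℕ} (t : Fin s → ℕ) (q : ℕ) (χ : V → V → K)
    (hχ : ∀ x y, χ x y = χ y x) (hq : ∀ x k, #{y | y ≠ x ∧ χ x y = k} ≤ q) (u : Fin s → ℕ)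
    (hu : ∀ i, q * u i < t i) (hK : Fintype.card K ≤ ∑ i, u i) (hN : Fintype.card V = N) :
    ¬ Arrows (⊤ : SimpleGraph (Fin N)) (fun i => star_S (t i)) := by
  obtain ⟨f, hf⟩ := exists_map_card_fiber_le u hK
  refine not_arrows_of_coloring hN (fun x y => f (χ x y)) (fun x y => by rw [hχ]) fun i => ?_
  refine not_star_isContained_colorGraph fun x => lt_of_le_of_lt ?_ (hu i)
  calc #{y | y ≠ x ∧ f (χ x y) = i}
      ≤ #(({k | f k = i} : Finset K).biUnion fun k => {y | y ≠ x ∧ χ x y = k}) := by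
        refine card_le_card fun y hy => ?_
        simpa [and_comm] using hy
    _ ≤ ∑ k ∈ ({k | f k = i} : Finset K), #{y | y ≠ x ∧ χ x y = k} := card_biUnion_le
    _ ≤ ∑ _k ∈ ({k | f k = i} : Finset K), q := sum_le_sum fun k _ => hq x k
    _ = q * #{k | f k = i} := by rw [sum_const, smul_eq_mul, mul_comm]
    _ ≤ q * u i := Nat.mul_le_mul_left _ (hf i)

/-- The standard 1-factorization of the complete graph on `m + 1` vertices, `m` odd. -/
def roundRobin (m : ℕ) : Option (ZMod m) → Option (ZMod m) → ZMod m
  | some x, some y => x + y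
  | some x, none => x + x
  | none, some x => x + x
  | none, none => 0

theorem roundRobin_comm (m : ℕ) (x y : Option (ZMod m)) : roundRobin m x y = roundRobin m y x := by
  rcases x with _ | x <;> rcases y with _ | y <;> simp [roundRobin, add_comm]

theorem roundRobin_injOn {m : ℕ} (hm : Odd m) (x y z : Option (ZMod m)) (hy : y ≠ x) (hz : z ≠ x)
    (h : roundRobin m x y = roundRobin m x z) : y = z := by
  have hdouble : ∀ a b : ZMod m, a + a = b + b → a = b := by
    intro a b hab
    have h2 : IsUnit (2 : ZMod m) := by
      have : IsUnit ((2 : ℕ) : ZMod m) :=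
        (ZMod.isUnit_iff_coprime 2 m).2 (Nat.coprime_two_left.2 hm)
      simpa using this
    exact h2.mul_left_cancel (by rw [two_mul, two_mul, hab])
  rcases x with _ | x <;> rcases y with _ | y <;> rcases z with _ | z <;>
    simp_all [roundRobin]
  exact hdouble _ _ h

/-- The `m` perfect matchings of the 1-factorization are shared out, at most `t i - 1` to colour
`i`. -/
theorem not_arrows_star_of_odd {s m : ℕ} (t : Fin s → ℕ) (ht : ∀ i, 0 < t i) (hm : Odd m)
    (hS : m ≤ ∑ i, (t i - 1)) :
    ¬ Arrows (⊤ : SimpleGraph (Fin (m + 1))) (fun i => star_S (t i)) := by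
  have : NeZero m := ⟨hm.pos.ne'⟩
  refine not_arrows_star_of_coloring t 1 (roundRobin m) (roundRobin_comm m) ?_
    (fun i => t i - 1) (fun i => by have := ht i; omega) (by simpa [ZMod.card] using hS)
    (by simp [ZMod.card])
  intro x k
  rw [card_le_one]
  intro y hy z hz
  simp only [mem_filter, mem_univ, true_and] at hy hz
  exact roundRobin_injOn hm x y z hy.1 hz.1 (hy.2.trans hz.2.symm)

/-- The pairs at a fixed cyclic distance in `ZMod (2 * m + 1)` form a 2-factor; colour `i` receives
at most `(t i - 1) / 2` of the `m` 2-factors. -/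
theorem not_arrows_star_of_forall_odd {s m : ℕ} (t : Fin s → ℕ) (ht : ∀ i, Odd (t i)) (hm : 0 < m)
    (hS : 2 * m = ∑ i, (t i - 1)) :
    ¬ Arrows (⊤ : SimpleGraph (Fin (2 * m + 1))) (fun i => star_S (t i)) := by
  let d : ZMod (2 * m + 1) → ℕ := fun a => a.valMinAbs.natAbs
  have hdle : ∀ a, d a ≤ m := fun a => by
    have h : d a ≤ (2 * m + 1) / 2 := ZMod.natAbs_valMinAbs_le a
    omega
  have hd0 : ∀ a, a ≠ 0 → 0 < d a := fun a ha =>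
    Int.natAbs_pos.2 (by simpa [ZMod.valMinAbs_eq_zero] using ha)
  have hdneg : ∀ a, d (-a) = d a := fun a => ZMod.natAbs_valMinAbs_neg a
  have hdeq : ∀ a b, d a = d b → a = b ∨ a = -b := by
    intro a b hab
    rcases Int.natAbs_eq_natAbs_iff.1 hab with h | h
    · exact Or.inl (by rw [← ZMod.coe_valMinAbs a, h, ZMod.coe_valMinAbs])
    · exact Or.inr (by rw [← ZMod.coe_valMinAbs a, h, Int.cast_neg, ZMod.coe_valMinAbs])
  refine not_arrows_star_of_coloring t 2
    -- Distances run from `1` to `m`, so the reduction modulo `m` changes nothing and only supplies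
    -- the bound for `Fin m`.
    (fun x y => (⟨(d (x - y) - 1) % m, Nat.mod_lt _ hm⟩ : Fin m)) ?_ ?_
    (fun i => (t i - 1) / 2) ?_ ?_ (ZMod.card _)
  · intro x y
    simp only [← hdneg (x - y), neg_sub]
  · intro x k
    rcases eq_empty_or_nonempty ({y | y ≠ x ∧
      (⟨(d (x - y) - 1) % m, Nat.mod_lt _ hm⟩ : Fin m) = k} : Finset (ZMod (2 * m + 1)))
      with h | ⟨z, hz⟩
    · rw [h]; simp
    · refine (card_le_card (t := {z, x + x - z}) ?_).trans card_le_two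
      intro y hy
      simp only [mem_filter, mem_univ, true_and] at hy hz
      have h1 := congrArg Fin.val (hy.2.trans hz.2.symm)
      have hy0 := hd0 (x - y) (sub_ne_zero.2 hy.1.symm)
      have hz0 := hd0 (x - z) (sub_ne_zero.2 hz.1.symm)
      have hyle := hdle (x - y)
      have hzle := hdle (x - z)
      simp only at h1
      rw [Nat.mod_eq_of_lt (by omega), Nat.mod_eq_of_lt (by omega)] at h1
      rw [mem_insert, mem_singleton]
      rcases hdeq (x - y) (x - z) (by omega) with h2 | h2
      · exact Or.inl (sub_right_injective h2)
      · refine Or.inr ?_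
        linear_combination -h2
  · intro i
    obtain ⟨a, ha⟩ := ht i
    omega
  · rw [Fintype.card_fin]
    have : ∑ i, (t i - 1) = 2 * ∑ i, (t i - 1) / 2 := by
      rw [mul_sum]
      refine sum_congr rfl fun i _ => ?_
      obtain ⟨a, ha⟩ := ht i
      omega
    omega

theorem not_arrows_star_one {s : ℕ} (t : Fin s → ℕ) (ht : ∀ i, 0 < t i) :
    ¬ Arrows (⊤ : SimpleGraph (Fin 1)) (fun i => star_S (t i)) := by
  classical
  intro h
  have hempty : IsEmpty (⊤ : SimpleGraph (Fin 1)).edgeSet := by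
    rw [Set.isEmpty_coe_sort, SimpleGraph.edgeSet_eq_empty]
    exact Subsingleton.elim _ _
  -- This colouring exists even if `s = 0` and there are no colours, as there are no edges.
  obtain ⟨i, hi⟩ := h (fun e => hempty.elim e)
  obtain ⟨v, hv⟩ := (star_isContained_iff _).1 hi
  have h1 := hv.trans_lt (SimpleGraph.degree_lt_card_verts _)
  rw [Fintype.card_fin] at h1
  exact absurd (ht i) (by omega)

theorem arrows_star {s N : ℕ} (t : Fin s → ℕ) (ht : ∀ i, 0 < t i)
    (h : ∑ i, (t i - 1) + 2 ≤ N ∨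
      (N = ∑ i, (t i - 1) + 1 ∧ Even (∑ i, (t i - 1)) ∧ ∃ i, Even (t i))) :
    Arrows (⊤ : SimpleGraph (Fin N)) (fun i => star_S (t i)) := by
  classical
  intro C
  by_contra hC
  have hdlt : ∀ i v, (C.labelGraph i).degree v < t i := fun i v =>
    degree_lt_of_not_isContained (fun hs => hC ⟨i, hs⟩) v
  have hcov : ∀ x y, x ≠ y → ∃ i, (C.labelGraph i).Adj x y := fun x y hxy =>
    exists_labelGraph_adj C hxy
  rcases h with h | ⟨h, hS, heven⟩
  · have h1 := card_le_sum_degree_add_one (fun i => C.labelGraph i) hcov ⟨0, by omega⟩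
    rw [Fintype.card_fin] at h1
    have h2 : ∑ i, (C.labelGraph i).degree ⟨0, by omega⟩ ≤ ∑ i, (t i - 1) :=
      sum_le_sum fun i _ => by have := hdlt i ⟨0, by omega⟩; omega
    omega
  · exact not_cover_of_even_sum t ht (fun i => C.labelGraph i) hcov hdlt (by simpa using h) hS heven

/-- The multicolour Ramsey number of stars. -/
theorem ramseyNumber_star {s : ℕ} (t : Fin s → ℕ) (ht : ∀ i, 0 < t i) :
    ramseyNumber (fun i => star_S (t i)) =
      if Even (∑ i, (t i - 1)) ∧ ∃ i, Even (t i) then ∑ i, (t i - 1) + 1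
      else ∑ i, (t i - 1) + 2 := by
  split_ifs with h
  · refine ramseyNumber_eq_succ (arrows_star t ht (Or.inr ⟨rfl, h⟩)) ?_
    obtain ⟨hS, i, m, hi⟩ := h
    have h1 : t i - 1 ≤ ∑ i, (t i - 1) :=
      single_le_sum (f := fun i => t i - 1) (fun _ _ => Nat.zero_le _) (mem_univ i)
    have h2 := ht i
    have h3 := not_arrows_star_of_odd (m := ∑ i, (t i - 1) - 1) t ht
      (Nat.Even.sub_odd (by omega) hS odd_one) (Nat.sub_le _ _)
    rwa [Nat.sub_add_cancel (by omega)] at h3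
  · refine ramseyNumber_eq_succ (arrows_star t ht (Or.inl le_rfl)) ?_
    rcases Nat.even_or_odd (∑ i, (t i - 1)) with hS | hS
    · have hodd : ∀ i, Odd (t i) := fun i => by
        rw [← Nat.not_even_iff_odd]
        exact fun hi => h ⟨hS, i, hi⟩
      rcases Nat.eq_zero_or_pos (∑ i, (t i - 1)) with h0 | h0
      · rw [h0]
        exact not_arrows_star_one t ht
      · obtain ⟨m, hm⟩ := hS
        have := not_arrows_star_of_forall_odd (m := m) t hodd (by omega) (by omega)
        rwa [show 2 * m + 1 = ∑ i, (t i - 1) + 1 by omega] at this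
    · exact not_arrows_star_of_odd t ht hS le_rfl

/-! ### Constructions for the lower bound. -/

/-- Extending a colouring of a complete graph on `W` by `x j` vertices for each stripe colour `j`,
all edges at which get the colour `j`. -/
def extendColoring {W κ : Type} {c : ℕ} (χ : W → W → κ ⊕ Fin c) (x : Fin c → ℕ) :
    W ⊕ (Σ j, Fin (x j)) → W ⊕ (Σ j, Fin (x j)) → κ ⊕ Fin c
  | Sum.inl a, Sum.inl b => χ a b
  | Sum.inl _, Sum.inr z => Sum.inr z.1
  | Sum.inr z, Sum.inl _ => Sum.inr z.1
  | Sum.inr z, Sum.inr z' => Sum.inr (min z.1 z'.1)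

theorem extendColoring_comm {W κ : Type} {c : ℕ} {χ : W → W → κ ⊕ Fin c}
    (hχ : ∀ a b, χ a b = χ b a) (x : Fin c → ℕ) (u v : W ⊕ (Σ j, Fin (x j))) :
    extendColoring χ x u v = extendColoring χ x v u := by
  rcases u with a | z <;> rcases v with b | z'
  · exact hχ a b
  · rfl
  · rfl
  · simp [extendColoring, min_comm]

/-- The weight `w j` bounds the matchings of colour `j` inside `W`. An added vertex of colour `j`
gets weight `2`, which covers all its edges, and it meets no star colour. -/
theorem not_arrows_of_extension {W : Type} [Fintype W] [DecidableEq W] {s c N : ℕ} (t : Fin s → ℕ)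
    (n : Fin c → ℕ) (ht : ∀ i, 0 < t i) (χ : W → W → Fin s ⊕ Fin c) (hχ : ∀ a b, χ a b = χ b a)
    (x : Fin c → ℕ) (w : Fin c → W → ℕ)
    (hw : ∀ j a b, a ≠ b → χ a b = Sum.inr j → 2 ≤ w j a + w j b)
    (hsum : ∀ j, ∑ a, w j a + 2 * x j < 2 * n j)
    (hstar : ∀ i a, #{b | b ≠ a ∧ χ a b = Sum.inl i} < t i)
    (hN : Fintype.card W + ∑ j, x j = N) :
    ¬ Arrows (⊤ : SimpleGraph (Fin N))
      (Sum.elim (fun i => star_S (t i)) (fun j => stripe (n j))) := by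
  refine not_arrows_of_coloring (V := W ⊕ (Σ j, Fin (x j))) (by simpa using hN)
    (extendColoring χ x) (extendColoring_comm hχ x) ?_
  rintro (i | j)
  · refine not_star_isContained_colorGraph ?_
    rintro (a | z)
    · refine lt_of_le_of_lt ?_ (hstar i a)
      rw [← card_map (Function.Embedding.inl : W ↪ W ⊕ (Σ j, Fin (x j)))]
      refine card_le_card ?_
      rintro (b | z) hb
      · obtain ⟨-, hne, hcol⟩ := mem_filter.1 hb
        exact mem_map.2 ⟨b, mem_filter.2 ⟨mem_univ _, fun h => hne (congrArg _ h), hcol⟩, rfl⟩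
      · cases (mem_filter.1 hb).2.2
    · refine lt_of_eq_of_lt ?_ (ht i)
      rw [card_eq_zero, filter_eq_empty_iff]
      rintro (b | z') - <;> simp [extendColoring]
  · intro hcont
    have h1 := two_mul_le_sum_of_stripe_isContained
      (Sum.elim (w j) fun z => if z.1 = j then 2 else 0) ?_ hcont
    · have h2 : ∑ z : Σ j, Fin (x j), (if z.1 = j then 2 else 0) = 2 * x j := by
        rw [Fintype.sum_sigma, sum_eq_single j]
        · simp [mul_comm]
        · intro k _ hk
          simp [hk]
        · simp
      rw [Fintype.sum_sum_type] at h1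
      simp only [Sum.elim_inl, Sum.elim_inr, h2] at h1
      have := hsum j
      omega
    · rintro (a | z) (b | z') ⟨hne, hcol⟩
      · exact hw j a b (fun h => hne (congrArg _ h)) hcol
      · have h2 : z'.1 = j := Sum.inr_injective hcol
        simp [h2]
      · have h2 : z.1 = j := Sum.inr_injective hcol
        simp [h2]
      · have h2 : min z.1 z'.1 = j := Sum.inr_injective hcol
        rcases min_choice z.1 z'.1 with h3 | h3 <;> rw [h3] at h2 <;> simp [h2]

/-- The core is a clique of `2 * n j₀ - 1` vertices in colour `j₀`; every other stripe colour `j`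
adds `n j - 1` vertices. -/
theorem not_arrows_of_monochromatic {s c : ℕ} (t : Fin s → ℕ) (n : Fin c → ℕ)
    (ht : ∀ i, 0 < t i) (hn : ∀ j, 0 < n j) (j₀ : Fin c) :
    ¬ Arrows (⊤ : SimpleGraph (Fin (n j₀ + ∑ j, (n j - 1))))
      (Sum.elim (fun i => star_S (t i)) (fun j => stripe (n j))) := by
  refine not_arrows_of_extension (W := Fin (2 * n j₀ - 1)) t n ht (fun _ _ => Sum.inr j₀)
    (fun _ _ => rfl) (fun j => if j = j₀ then 0 else n j - 1) (fun j _ => if j = j₀ then 1 else 0)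
    ?_ ?_ ?_ ?_
  · intro j a b _ hj
    simp [Sum.inr_injective hj]
  · intro j
    have := hn j
    by_cases hj : j = j₀
    · subst hj
      simp only [if_true, sum_const, card_univ, Fintype.card_fin, smul_eq_mul]
      omega
    · simp only [if_neg hj, sum_const_zero]
      omega
  · intro i a
    simpa using ht i
  · rw [Fintype.card_fin, ← add_sum_erase univ _ (mem_univ j₀),
      ← add_sum_erase univ (fun j => n j - 1) (mem_univ j₀), if_pos rfl,
      sum_congr rfl fun j hj => if_neg (ne_of_mem_erase hj)]
    have := hn j₀
    omega

theorem not_arrows_of_not_arrows_star {s c R : ℕ} (t : Fin s → ℕ) (n : Fin c → ℕ)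
    (ht : ∀ i, 0 < t i) (hn : ∀ j, 0 < n j) (j₀ : Fin c)
    (hR : ¬ Arrows (⊤ : SimpleGraph (Fin R)) (fun i => star_S (t i))) :
    ¬ Arrows (⊤ : SimpleGraph (Fin (R + ∑ j, (n j - 1))))
      (Sum.elim (fun i => star_S (t i)) (fun j => stripe (n j))) := by
  classical
  unfold Arrows at hR
  push Not at hR
  obtain ⟨C, hC⟩ := hR
  refine not_arrows_of_extension (W := Fin R) t n ht
    (fun a b => if h : a ≠ b then Sum.inl (C.get a b h) else Sum.inr j₀) ?_
    (fun j => n j - 1) (fun _ _ => 0) ?_ ?_ ?_ (by simp)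
  · intro a b
    by_cases h : a = b
    · simp [h]
    · rw [dif_pos h, dif_pos (Ne.symm h)]
      exact congrArg Sum.inl (SimpleGraph.EdgeLabeling.get_comm b a _)
  · intro j a b hab hj
    rw [dif_pos hab] at hj
    cases hj
  · intro j
    have := hn j
    simp only [sum_const_zero]
    omega
  · intro i a
    refine lt_of_eq_of_lt ?_ (degree_lt_of_not_isContained
      (fun hs => (not_nonempty_iff.2 (hC i)) hs : ¬ (star_S (t i)).2.IsContained (C.labelGraph i)) a)
    rw [← SimpleGraph.card_neighborFinset_eq_degree]
    congr 1
    ext b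
    rw [SimpleGraph.mem_neighborFinset, SimpleGraph.TopEdgeLabeling.labelGraph_adj, mem_filter]
    simp only [mem_univ, true_and]
    constructor
    · rintro ⟨hne, hb⟩
      rw [dif_pos hne.symm] at hb
      exact ⟨hne.symm, Sum.inl_injective hb⟩
    · rintro ⟨hne, hb⟩
      exact ⟨hne.symm, by rw [dif_pos hne, hb]⟩

/-- Two cliques of two stripe colours that share one vertex; the remaining pairs form a complete
bipartite graph and are coloured by means of a Latin square. -/
def twoCliqueColoring {m : ℕ} {κ ι : Type} (f : ZMod m → κ) (j : Bool → ι) :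
    Option (Bool × ZMod m) → Option (Bool × ZMod m) → κ ⊕ ι
  | some (β, x), some (γ, y) => if β = γ then Sum.inr (j β) else Sum.inl (f (x + y))
  | some (β, _), none => Sum.inr (j β)
  | none, some (β, _) => Sum.inr (j β)
  | none, none => Sum.inr (j true)

theorem twoCliqueColoring_comm {m : ℕ} {κ ι : Type} (f : ZMod m → κ) (j : Bool → ι)
    (u v : Option (Bool × ZMod m)) : twoCliqueColoring f j u v = twoCliqueColoring f j v u := by
  rcases u with _ | ⟨β, x⟩ <;> rcases v with _ | ⟨γ, y⟩
  · rfl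
  · rfl
  · rfl
  · by_cases h : β = γ
    · simp [twoCliqueColoring, h]
    · simp [twoCliqueColoring, h, Ne.symm h, add_comm]

/-- The two cliques have `2 * m + 1` vertices each, `4 * m + 1` in all, and each uses up `m` of its
stripe's `n - 1` edges: a net gain of `2 * m + 1` vertices. The Latin square splits the bipartite
part into `2 * m` perfect matchings, exactly the total capacity of the star colours. -/
theorem not_arrows_of_two_cliques {s c : ℕ} (t : Fin s → ℕ) (n : Fin c → ℕ) (ht : ∀ i, 0 < t i)
    (hn : ∀ j, 0 < n j) (j : Bool → Fin c) (hj : Function.Injective j) (m : ℕ)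
    (hS : ∑ i, (t i - 1) = 2 * m) (hm : 0 < m) (hmn : ∀ β, m + 1 ≤ n (j β)) :
    ¬ Arrows (⊤ : SimpleGraph (Fin (2 * m + 1 + ∑ j, (n j - 1))))
      (Sum.elim (fun i => star_S (t i)) (fun j => stripe (n j))) := by
  have : NeZero (2 * m) := ⟨by omega⟩
  obtain ⟨f, hf⟩ := exists_map_card_fiber_le (K := ZMod (2 * m)) (fun i => t i - 1)
    (by rw [ZMod.card, hS])
  have hcard : ∀ β k, #{u : Option (Bool × ZMod (2 * m)) | u = none ∨ ∃ y, u = some (β, y)} = k →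
      k = 2 * m + 1 := by
    rintro β k rfl
    have h1 : ({u | u = none ∨ ∃ y, u = some (β, y)} : Finset (Option (Bool × ZMod (2 * m)))) =
        insertNone (univ.map (Function.Embedding.sectR β (ZMod (2 * m)))) := by
      ext (_ | ⟨γ, y⟩)
      · simp
      · simp [eq_comm]
    rw [h1, card_insertNone, card_map, card_univ, ZMod.card]
  refine not_arrows_of_extension t n ht (twoCliqueColoring f j) (twoCliqueColoring_comm f j)
    (fun i => n i - 1 - if ∃ β, i = j β then m else 0)
    (fun i u => if ∃ β, i = j β ∧ (u = none ∨ ∃ y, u = some (β, y)) then 1 else 0) ?_ ?_ ?_ ?_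
  · intro i u v huv hi
    have hmem : ∀ β, i = j β → (u = none ∨ ∃ y, u = some (β, y)) →
        (v = none ∨ ∃ y, v = some (β, y)) → 2 ≤
        (if ∃ β, i = j β ∧ (u = none ∨ ∃ y, u = some (β, y)) then 1 else 0) +
        (if ∃ β, i = j β ∧ (v = none ∨ ∃ y, v = some (β, y)) then 1 else 0) := by
      intro β h1 h2 h3
      rw [if_pos ⟨β, h1, h2⟩, if_pos ⟨β, h1, h3⟩]
    rcases u with _ | ⟨β, x⟩ <;> rcases v with _ | ⟨γ, y⟩
    · exact absurd rfl huv
    · exact hmem γ (Sum.inr_injective hi).symm (Or.inl rfl) (Or.inr ⟨y, rfl⟩)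
    · exact hmem β (Sum.inr_injective hi).symm (Or.inr ⟨x, rfl⟩) (Or.inl rfl)
    · by_cases h : β = γ
      · subst h
        simp only [twoCliqueColoring, if_true] at hi
        exact hmem β (Sum.inr_injective hi).symm (Or.inr ⟨x, rfl⟩) (Or.inr ⟨y, rfl⟩)
      · simp [twoCliqueColoring, h] at hi
  · intro i
    by_cases hi : ∃ β, i = j β
    · obtain ⟨β, rfl⟩ := hi
      have h1 : ∀ u : Option (Bool × ZMod (2 * m)), (∃ γ, j β = j γ ∧
          (u = none ∨ ∃ y, u = some (γ, y))) ↔ (u = none ∨ ∃ y, u = some (β, y)) := by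
        intro u
        constructor
        · rintro ⟨γ, h, hu⟩
          rwa [hj h]
        · exact fun hu => ⟨β, rfl, hu⟩
      simp only [h1]
      rw [if_pos ⟨β, rfl⟩, ← card_filter, hcard β _ rfl]
      have := hmn β
      omega
    · have h1 : ∀ u : Option (Bool × ZMod (2 * m)), ¬ ∃ γ, i = j γ ∧
          (u = none ∨ ∃ y, u = some (γ, y)) := by
        rintro u ⟨γ, h, -⟩
        exact hi ⟨γ, h⟩
      simp only [if_neg hi, if_neg (h1 _), sum_const_zero]
      have := hn i
      omega
  · rintro i (_ | ⟨β, x⟩)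
    · refine lt_of_eq_of_lt ?_ (ht i)
      rw [card_eq_zero, filter_eq_empty_iff]
      rintro (_ | ⟨γ, y⟩) - <;> simp [twoCliqueColoring]
    · refine lt_of_le_of_lt ?_ (lt_of_le_of_lt (hf i) (Nat.sub_lt (ht i) one_pos))
      have hfib : ∀ u, u ≠ some (β, x) ∧ twoCliqueColoring f j (some (β, x)) u = Sum.inl i →
          ∃ y, u = some (!β, y) ∧ f (x + y) = i := by
        rintro (_ | ⟨γ, y⟩) ⟨-, hu⟩
        · simp [twoCliqueColoring] at hu
        · by_cases h : β = γ
          · simp [twoCliqueColoring, h] at hu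
          · simp only [twoCliqueColoring, if_neg h] at hu
            refine ⟨y, ?_, Sum.inl_injective hu⟩
            have : γ = !β := by revert h; cases β <;> cases γ <;> simp
            rw [this]
      -- A neighbour `(!β, y)` is sent to the Latin square entry `x + y`; the default `0` is never
      -- used, as the shared vertex has no star-coloured edge.
      refine card_le_card_of_injOn (fun u => x + (u.map Prod.snd).getD 0) ?_ ?_
      · intro u hu
        simp only [coe_filter, mem_univ, true_and, Set.mem_ofPred_eq] at hu ⊢
        obtain ⟨y, rfl, hy⟩ := hfib u hu
        exact hy
      · intro u hu v hv huv
        simp only [coe_filter, mem_univ, true_and, Set.mem_ofPred_eq] at hu hv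
        obtain ⟨y, rfl, -⟩ := hfib u hu
        obtain ⟨z, rfl, -⟩ := hfib v hv
        have : y = z := by simpa using huv
        rw [this]
  · have h1 : ∑ i, (n i - 1 - if ∃ β, i = j β then m else 0) + ∑ i, (if ∃ β, i = j β then m else 0) =
        ∑ i, (n i - 1) := by
      rw [← sum_add_distrib]
      refine sum_congr rfl fun i _ => Nat.sub_add_cancel ?_
      split_ifs with hi
      · obtain ⟨β, rfl⟩ := hi
        have := hmn β
        omega
      · exact Nat.zero_le _
    have h2 : ∑ i, (if ∃ β, i = j β then m else 0) = 2 * m := by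
      rw [← sum_filter, sum_const, smul_eq_mul]
      congr 1
      have : (univ.filter fun i => ∃ β, i = j β) = univ.map ⟨j, hj⟩ := by
        ext i
        simp [or_comm]
      rw [this, card_map, card_univ, Fintype.card_bool]
    rw [Fintype.card_option, Fintype.card_prod, Fintype.card_bool, ZMod.card]
    omega

/-! ### Assembling the two bounds. -/

theorem not_arrows_of_lt_ramseyNumber {ι : Type} {G : ι → BundledGraph} {N : ℕ} (hN : 0 < N)
    (h : N < ramseyNumber G) : ¬ Arrows (⊤ : SimpleGraph (Fin N)) G := fun hA =>
  absurd (Nat.sInf_le (s := {N | 0 < N ∧ Arrows (⊤ : SimpleGraph (Fin N)) G}) ⟨hN, hA⟩) (not_le.2 h)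

theorem two_mul_le_of_secondEntry {c : ℕ} {n : Fin c → ℕ} (hmono : Antitone n) {S : ℕ}
    (hS : 2 * secondEntry n ≤ S) (j : Fin c) (hj : j.1 ≠ 0) : 2 * n j ≤ S := by
  have hc : 1 < c := by have := j.2; omega
  rw [secondEntry, dif_pos hc] at hS
  have : n j ≤ n ⟨1, hc⟩ := hmono (Fin.mk_le_of_le_val (by omega))
  omega

/-- The Ramsey number of stars versus stripes in terms of `S` alone. -/
theorem ramseyNumber_star_stripe {s c : ℕ} (hc : 0 < c) (t : Fin s → ℕ) (n : Fin c → ℕ)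
    (ht : ∀ i, 0 < t i) (hn : ∀ i, 0 < n i) (hmono : Antitone n) (S : ℕ)
    (hS : S = ∑ i, (t i - 1)) (ρ : ℕ)
    (hρ : ρ = if max (n ⟨0, hc⟩) (2 * secondEntry n) ≤ S ∧ Even S ∧ ∃ i, Even (t i)
      then S else S + 1) :
    ramseyNumber (Sum.elim (fun i => star_S (t i)) (fun j => stripe (n j))) =
      max ρ (n ⟨0, hc⟩) + ∑ j, (n j - 1) + 1 := by
  have hr := ramseyNumber_star t ht
  have hle : ∀ j, n j ≤ n ⟨0, hc⟩ := fun j => hmono (Fin.mk_le_of_le_val (Nat.zero_le _))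
  have hn₀ := hn ⟨0, hc⟩
  rw [← hS] at hr
  apply ramseyNumber_eq_succ
  · refine arrows_star_stripe t n ht hn (n ⟨0, hc⟩) hle ⟨0, hc⟩ (by omega) ?_
    rw [← hS]
    split_ifs at hρ with h
    · refine Or.inr ⟨by omega, h.2.1, h.2.2, by omega, fun j hj => ?_⟩
      exact two_mul_le_of_secondEntry hmono (by omega) j fun h0 => hj (Fin.ext h0)
    · exact Or.inl (by omega)
  · rcases le_total ρ (n ⟨0, hc⟩) with h₀ | h₀
    · rw [max_eq_right h₀]
      exact not_arrows_of_monochromatic t n ht hn ⟨0, hc⟩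
    rw [max_eq_left h₀]
    by_cases hlt : ρ < ramseyNumber fun i => star_S (t i)
    · exact not_arrows_of_not_arrows_star t n ht hn ⟨0, hc⟩
        (not_arrows_of_lt_ramseyNumber (by omega) hlt)
    -- Here `ρ` equals the star Ramsey number `S + 1`, so no star-free core on `ρ` vertices exists.
    -- Either `n₁ = S + 1` and the monochromatic core serves, or `S < 2n₂` and the two cliques do.
    · rw [hr] at hlt
      split_ifs at hlt with h
      · have hmax : ¬ max (n ⟨0, hc⟩) (2 * secondEntry n) ≤ S := by
          intro hmax
          rw [if_pos ⟨hmax, h⟩] at hρ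
          omega
        rw [if_neg fun h' => hmax h'.1] at hρ
        by_cases hSn : S < n ⟨0, hc⟩
        · rw [hρ, show S + 1 = n ⟨0, hc⟩ by omega]
          exact not_arrows_of_monochromatic t n ht hn ⟨0, hc⟩
        have hsecond : S < 2 * secondEntry n := by omega
        have hc1 : 1 < c := by
          by_contra hc1
          rw [secondEntry, dif_neg hc1] at hsecond
          omega
        rw [secondEntry, dif_pos hc1] at hsecond
        obtain ⟨m, hm⟩ := h.1
        rw [hρ, show S + 1 = 2 * m + 1 by omega]
        refine not_arrows_of_two_cliques t n ht hn (fun β => if β then ⟨1, hc1⟩ else ⟨0, hc⟩) ?_ m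
          (by omega) (by omega) ?_
        · intro β γ h
          cases β <;> cases γ <;> simp_all
        · have := hle ⟨1, hc1⟩
          rintro (_ | _)
          · simp only [Bool.false_eq_true, if_false]
            omega
          · simp only [if_true]
            omega
      · have : ρ ≤ S + 1 := by rw [hρ]; split_ifs <;> omega
        omega

theorem theorem2 (s c : ℕ) (hc : 0 < c) (t : Fin s → ℕ) (n : Fin c → ℕ)
    (ht : ∀ i, 0 < t i) (hn : ∀ i, 0 < n i) (hmono : Antitone n)
    (S : ℕ) (hS : S = ∑ i, (t i - 1))
    (r : ℕ) (hr : r = ramseyNumber (fun i => star_S (t i)))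
    (δ : ℤ) (hδ : δ = if S < max (n ⟨0, hc⟩) (2 * secondEntry n) ∧ Even S ∧ ∃ i, Even (t i)
      then 0 else -1) :
    (ramseyNumber (Sum.elim (fun i => star_S (t i)) (fun j => stripe (n j))) : ℤ) =
      max ((r : ℤ) + δ) (n ⟨0, hc⟩ : ℤ) + ∑ j, ((n j : ℤ) - 1) + 1 := by
  rw [ramseyNumber_star t ht, ← hS] at hr
  have hsum : ∑ j, ((n j : ℤ) - 1) = ((∑ j, (n j - 1) : ℕ) : ℤ) := by
    rw [Nat.cast_sum]
    exact sum_congr rfl fun j _ => by rw [Nat.cast_sub (hn j), Nat.cast_one]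
  rw [ramseyNumber_star_stripe hc t n ht hn hmono S hS _ rfl, hsum]
  push_cast
  congr 3
  by_cases h : Even S ∧ ∃ i, Even (t i)
  · rw [if_pos h] at hr
    by_cases hlt : S < max (n ⟨0, hc⟩) (2 * secondEntry n)
    · rw [if_pos ⟨hlt, h⟩] at hδ
      rw [if_neg fun h' => absurd hlt (not_lt.2 h'.1), hr, hδ]
      push_cast
      ring
    · rw [if_neg fun h' => hlt h'.1] at hδ
      rw [if_pos ⟨not_lt.1 hlt, h⟩, hr, hδ]
      push_cast
      ring
  · rw [if_neg h] at hr
    rw [if_neg fun h' => h h'.2] at hδ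
    rw [if_neg fun h' => h h'.2, hr, hδ]
    push_cast
    ring
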